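/- Let $m\ge 0$, let $S\subseteq\mathbb C$ be a parameter set (for instance a real interval around $0$, a half-line, a punctured disc or a sector), and let $A(\rho)\in\mathbb C^{m\times m}$ be a family of matrices having a full asymptotic expansion $$A(\rho)\sim A_0+\rho A_1+\rho^2A_2+\cdots,\qquad \rho\to0,\ \rho\in S,$$ meaning that $A(\rho)-\sum_{k<N}\rho^kA_k=\mathcal O(\rho^N)$ as $\rho\to 0$ in $S$, for every $N\ge 0$. Nothing else is assumed on $A$. Then there exists a family of invertible matrices $M(\rho)\in\mathbb C^{m\times m}$ having a full asymptotic expansion $M(\rho)\sim M_0+\rho M_1+\rho^2M_2+\cdots$ as $\rho\to0$ in $S$, with $M_0$ invertible, such that for all sufficiently small $\rho\in S$ the matrix $$M(\rho)^{-1}A(\rho)M(\rho)=\operatorname{diag}\bigl(B_1(\rho),\dots,B_d(\rho)\bigr)$$ is block-diagonal, with block sizes $n_1,\dots,n_d\ge1$ that do not depend on $\rho$, and each block $B_j(\rho)$ is either of dimension $1$ or of the form $$B_j(\rho)=p_k(\rho)\,\mathrm I+\rho^kJ+\mathcal O(\rho^{k+1}),\qquad \rho\to0,\ \rho\in S,$$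 for some integer $k\ge0$, where $p_k$ is a polynomial of degree at most $k$ and $J$ is a Jordan type matrix, i.e. its only non-zero entries are equal to $1$ and are located on the first upper side diagonal. Moreover, $J$ can be chosen non-zero for every block of dimension greater than $1$, except for blocks that are scalar to infinite order, i.e. blocks which for every $k\ge0$ are of the form $p_k(\rho)\,\mathrm I+\mathcal O(\rho^{k+1})$ with a polynomial $p_k$ of degree at most $k$. -/

import Mathlib

open Filter Topology Asymptotics

/-- `F(ρ) = O(ρ ^ N)` as `ρ → 0` in `S`, for a matrix family `F` (entrywise, which for matrices of a
fixed size is the same as in any norm). -/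
def MatBigO (S : Set ℂ) {n : ℕ} (F : ℂ → Matrix (Fin n) (Fin n) ℂ) (N : ℕ) : Prop :=
  ∀ i j, (fun ρ => F ρ i j) =O[𝓝[S] 0] (fun ρ : ℂ => ρ ^ N)

/-- The full asymptotic expansion `A(ρ) ∼ a 0 + ρ a 1 + ρ² a 2 + ⋯` as `ρ → 0` in `S`: for every `N`,
the difference of `A(ρ)` and the first `N` terms is `O(ρ ^ N)`. The set `S` is the parameter set,
for instance the real line, the positive half-line, a punctured disc or a sector. -/
def HasFullExpansion (S : Set ℂ) {n : ℕ} (A : ℂ → Matrix (Fin n) (Fin n) ℂ)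
    (a : ℕ → Matrix (Fin n) (Fin n) ℂ) : Prop :=
  ∀ N : ℕ, MatBigO S (fun ρ => A ρ - ∑ k ∈ Finset.range N, ρ ^ k • a k) N

/-- Jordan type matrix: the only nonzero entries are ones, on the first upper side diagonal. -/
def IsJordanType {n : ℕ} (J : Matrix (Fin n) (Fin n) ℂ) : Prop :=
  ∀ i j, J i j = 0 ∨ (J i j = 1 ∧ (j : ℕ) = (i : ℕ) + 1)

/-- The block `B(ρ)` is of the form `p(ρ) I + ρ ^ k J + O(ρ ^ (k + 1))` with a polynomial `p` of
degree at most `k`. -/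
def HasBlockForm (S : Set ℂ) {n : ℕ} (B : ℂ → Matrix (Fin n) (Fin n) ℂ) (k : ℕ)
    (J : Matrix (Fin n) (Fin n) ℂ) : Prop :=
  ∃ p : Polynomial ℂ, p.natDegree ≤ k ∧
    MatBigO S (fun ρ => B ρ - (p.eval ρ • (1 : Matrix (Fin n) (Fin n) ℂ) + ρ ^ k • J)) (k + 1)

/-- The `m × m` matrix `diag(B 0, …, B (d - 1))` with consecutive diagonal blocks `B j` of sizes
`n j`, where the sizes sum to `m`. -/
def bdiag {m d : ℕ} (n : Fin d → ℕ) (hn : ∑ j, n j = m)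
    (B : (j : Fin d) → Matrix (Fin (n j)) (Fin (n j)) ℂ) : Matrix (Fin m) (Fin m) ℂ :=
  Matrix.reindex (finSigmaFinEquiv.trans (finCongr hn)) (finSigmaFinEquiv.trans (finCongr hn))
    (Matrix.blockDiagonal' B)

/-! The proof is an induction on the matrix size. If every coefficient of the expansion of $A$ is
scalar, the whole matrix is one block, scalar to infinite order. Otherwise let $a_k$ be the first
non-scalar coefficient and $z$ an eigenvalue of it. If $a_k - z$ is nilpotent, a constant change of
basis puts it in Jordan form; the form is non-zero because $a_k$ is not scalar, so a single block
results. If not, the Fitting decomposition makes $a_k - z$ block-diagonal with a nilpotent and an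
invertible part, both of smaller size, and the perturbation $\rho C(\rho)$ must be decoupled without
losing the expansion (`exists_blockDiagonalization`). The two diagonal blocks have full expansions
again, and the induction applies to them (`IsBlockReducible.of_entriesIn`).

Decoupling by $1 + X$ with $X$ off-diagonal leads to a Riccati equation $X = \rho\Lambda(U + VX - XV
- XUX)$, where $\Lambda$ inverts a Sylvester operator. For each small $\rho$ a contraction gives a
solution in the unit ball. No regularity in $\rho$ is needed to expand it: a bounded solution of a
system $x_i = c_i + \rho g_i$, with $g_i$ polynomial in $x$ over the functions having expansions,
has an expansion itself (`mem_expansionRing_of_system`). Indeed, the algebra generated by $x$ and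
these functions consists of bounded functions and is stable under removing a suitable constant and
dividing by $\rho$; iterating this operation produces the coefficients
(`exists_hasScalarExpansion_of_stable`). -/

/-! ### Scalar functions with a full asymptotic expansion -/

/-- `f` has the full asymptotic expansion `∑ a k ρ ^ k` as `ρ → 0` in `S`. -/
def HasScalarExpansion (S : Set ℂ) (f : ℂ → ℂ) (a : ℕ → ℂ) : Prop :=
  ∀ N : ℕ, (fun ρ => f ρ - ∑ k ∈ Finset.range N, ρ ^ k * a k) =O[𝓝[S] 0] (fun ρ : ℂ => ρ ^ N)

theorem HasScalarExpansion.isBigO_one {S : Set ℂ} {f : ℂ → ℂ} {a : ℕ → ℂ}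
    (h : HasScalarExpansion S f a) : f =O[𝓝[S] 0] (fun _ => (1 : ℂ)) := by
  simpa using h 0

theorem HasScalarExpansion.congr {S : Set ℂ} {f g : ℂ → ℂ} {a : ℕ → ℂ}
    (h : HasScalarExpansion S f a) (hfg : f =ᶠ[𝓝[S] 0] g) : HasScalarExpansion S g a := fun N =>
  (h N).congr' (hfg.mono fun ρ hρ => by simp only [hρ]) EventuallyEq.rfl

theorem HasScalarExpansion.exists_shift {S : Set ℂ} {f : ℂ → ℂ} {a : ℕ → ℂ}
    (h : HasScalarExpansion S f a) :
    ∃ g, HasScalarExpansion S g (fun k => a (k + 1)) ∧ f =ᶠ[𝓝[S] 0] fun ρ => a 0 + ρ * g ρ := by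
  classical
  -- The parameter set may contain $0$, so the quotient needs a value there: `a 1` makes the
  -- remainder at $0$ vanish for positive order, and at order $0$ it is covered by the `‖a 1‖` in
  -- the bound.
  refine ⟨fun ρ => if ρ = 0 then a 1 else (f ρ - a 0) / ρ, fun N => ?_, ?_⟩
  · obtain ⟨C, hC⟩ := (h (N + 1)).bound
    refine IsBigO.of_bound (max C ‖a 1‖) (hC.mono fun ρ hρ => ?_)
    by_cases h0 : ρ = 0
    · subst h0
      rcases N with _ | N
      · simp
      · simp [Finset.sum_range_succ']
    · have hpos : 0 < ‖ρ‖ := norm_pos_iff.2 h0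
      have e : f ρ - ∑ k ∈ Finset.range (N + 1), ρ ^ k * a k
          = ρ * ((f ρ - a 0) / ρ - ∑ k ∈ Finset.range N, ρ ^ k * a (k + 1)) := by
        rw [Finset.sum_range_succ', mul_sub, Finset.mul_sum, mul_div_cancel₀ _ h0]
        simp only [pow_succ, pow_zero, one_mul]
        rw [sub_add_eq_sub_sub_swap]
        congr 1
        exact Finset.sum_congr rfl fun k _ => by ring
      rw [e, norm_mul, pow_succ, norm_mul, mul_comm ‖ρ ^ N‖, mul_left_comm] at hρ
      simp only [h0, if_false]
      exact (le_of_mul_le_mul_left hρ hpos).trans (by gcongr; exact le_max_left _ _)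
  · obtain ⟨C, hC⟩ := (h 1).bound
    filter_upwards [hC] with ρ hρ
    by_cases h0 : ρ = 0
    · subst h0
      simpa [sub_eq_zero] using hρ
    · simp only [h0, if_false]
      field_simp
      ring

theorem HasScalarExpansion.exists_shift_iterate {S : Set ℂ} {f : ℂ → ℂ} {a : ℕ → ℂ}
    (h : HasScalarExpansion S f a) (n : ℕ) :
    ∃ g, HasScalarExpansion S g (fun k => a (k + n)) ∧
      f =ᶠ[𝓝[S] 0] fun ρ => ∑ k ∈ Finset.range n, ρ ^ k * a k + ρ ^ n * g ρ := by
  induction n with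
  | zero => exact ⟨f, h, by simp⟩
  | succ n ih =>
    obtain ⟨g, hg, hfg⟩ := ih
    obtain ⟨g', hg', hgg⟩ := hg.exists_shift
    refine ⟨g', by simpa only [add_assoc, add_comm 1 n] using hg', ?_⟩
    filter_upwards [hfg, hgg] with ρ h1 h2
    rw [h1, h2, Finset.sum_range_succ]
    simp only [zero_add]
    ring

/-- A class of bounded functions which is stable under subtracting a constant and dividing by `ρ`
consists of functions with full expansions. -/
theorem exists_hasScalarExpansion_of_stable {S : Set ℂ} (T : Set (ℂ → ℂ))
    (hb : ∀ f ∈ T, f =O[𝓝[S] 0] (fun _ => (1 : ℂ)))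
    (hT : ∀ f ∈ T, ∃ c : ℂ, ∃ g ∈ T, f =ᶠ[𝓝[S] 0] fun ρ => c + ρ * g ρ) {f : ℂ → ℂ} (hf : f ∈ T) :
    ∃ a, HasScalarExpansion S f a := by
  choose! c g hg hfg using hT
  have hmem : ∀ N, g^[N] f ∈ T := fun N => by
    induction N with
    | zero => exact hf
    | succ N ih => rw [Function.iterate_succ_apply']; exact hg _ ih
  -- The coefficients are the constants removed successively; the $N$-th remainder is $\rho^N$ times
  -- a member of `T`, hence $O(\rho^N)$.
  refine ⟨fun k => c (g^[k] f), fun N => ?_⟩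
  have key : (fun ρ => f ρ - ∑ k ∈ Finset.range N, ρ ^ k * c (g^[k] f))
      =ᶠ[𝓝[S] 0] fun ρ => ρ ^ N * (g^[N] f) ρ := by
    induction N with
    | zero => simp
    | succ N ih =>
      filter_upwards [ih, hfg _ (hmem N)] with ρ h1 h2
      rw [Finset.sum_range_succ, ← sub_sub, h1, h2, Function.iterate_succ_apply']
      ring
  refine IsBigO.congr' ?_ key.symm EventuallyEq.rfl
  simpa using (isBigO_refl (fun ρ : ℂ => ρ ^ N) (𝓝[S] 0)).mul (hb _ (hmem N))

theorem isBigO_one_of_mem_adjoin {S : Set ℂ} {T : Set (ℂ → ℂ)}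
    (hb : ∀ f ∈ T, f =O[𝓝[S] 0] (fun _ => (1 : ℂ))) {f : ℂ → ℂ} (hf : f ∈ Algebra.adjoin ℂ T) :
    f =O[𝓝[S] 0] (fun _ => (1 : ℂ)) := by
  induction hf using Algebra.adjoin_induction with
  | mem f hf => exact hb f hf
  | algebraMap r => exact isBigO_const_const r one_ne_zero _
  | add f g _ _ hf hg => exact hf.add hg
  | mul f g _ _ hf hg => simpa using hf.mul hg

/-- Stability need only be checked on generators. It passes to products since $(c + \rho f')(d +
\rho g') = cd + \rho(cg' + df' + \rho f'g')$, and this is why the algebra has to contain $\rho$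
itself. -/
theorem exists_hasScalarExpansion_of_mem_adjoin {S : Set ℂ} {T : Set (ℂ → ℂ)}
    (hid : id ∈ Algebra.adjoin ℂ T) (hb : ∀ f ∈ T, f =O[𝓝[S] 0] (fun _ => (1 : ℂ)))
    (hT : ∀ f ∈ T, ∃ c : ℂ, ∃ g ∈ Algebra.adjoin ℂ T, f =ᶠ[𝓝[S] 0] fun ρ => c + ρ * g ρ)
    {f : ℂ → ℂ} (hf : f ∈ Algebra.adjoin ℂ T) : ∃ a, HasScalarExpansion S f a := by
  refine exists_hasScalarExpansion_of_stable (Algebra.adjoin ℂ T : Set (ℂ → ℂ))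
    (fun f hf => isBigO_one_of_mem_adjoin hb hf) (fun f hf => ?_) hf
  simp only [SetLike.mem_coe] at hf ⊢
  induction hf using Algebra.adjoin_induction with
  | mem f hf => exact hT f hf
  | algebraMap r => exact ⟨r, 0, zero_mem _, .of_forall fun ρ => by simp⟩
  | add f g _ _ hf hg =>
    obtain ⟨c, f', hf', hf⟩ := hf
    obtain ⟨d, g', hg', hg⟩ := hg
    refine ⟨c + d, f' + g', add_mem hf' hg', ?_⟩
    filter_upwards [hf, hg] with ρ h1 h2
    simp only [Pi.add_apply, h1, h2]
    ring
  | mul f g _ _ hf hg =>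
    obtain ⟨c, f', hf', hf⟩ := hf
    obtain ⟨d, g', hg', hg⟩ := hg
    refine ⟨c * d, c • g' + d • f' + id * f' * g',
      add_mem (add_mem (Subalgebra.smul_mem _ hg' c) (Subalgebra.smul_mem _ hf' d))
        (mul_mem (mul_mem hid hf') hg'), ?_⟩
    filter_upwards [hf, hg] with ρ h1 h2
    simp only [Pi.add_apply, Pi.mul_apply, Pi.smul_apply, smul_eq_mul, id, h1, h2]
    ring

theorem hasScalarExpansion_id (S : Set ℂ) :
    HasScalarExpansion S id (fun k => if k = 1 then 1 else 0) := by
  intro N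
  rcases N with _ | _ | N
  · simpa using (continuous_id.continuousWithinAt (s := S) (x := (0 : ℂ))).isBigO_one ℂ
  · simpa using isBigO_refl (fun ρ : ℂ => ρ) (𝓝[S] 0)
  · simpa [Finset.sum_ite_eq'] using isBigO_zero _ _

/-- The algebra of functions with a full asymptotic expansion as `ρ → 0` in `S`. -/
def expansionRing (S : Set ℂ) : Subalgebra ℂ (ℂ → ℂ) :=
  Algebra.adjoin ℂ {f | ∃ a, HasScalarExpansion S f a}

theorem mem_expansionRing {S : Set ℂ} {f : ℂ → ℂ} :
    f ∈ expansionRing S ↔ ∃ a, HasScalarExpansion S f a := by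
  refine ⟨fun hf => exists_hasScalarExpansion_of_mem_adjoin
    (Algebra.subset_adjoin (Set.mem_ofPred.2 ⟨_, hasScalarExpansion_id S⟩)) ?_ ?_ hf,
    fun h => Algebra.subset_adjoin h⟩
  · rintro f ⟨a, ha⟩
    exact ha.isBigO_one
  · rintro f ⟨a, ha⟩
    obtain ⟨g, hg, hfg⟩ := ha.exists_shift
    exact ⟨a 0, g, Algebra.subset_adjoin ⟨_, hg⟩, hfg⟩

theorem id_mem_expansionRing (S : Set ℂ) : id ∈ expansionRing S :=
  mem_expansionRing.2 ⟨_, hasScalarExpansion_id S⟩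

theorem isBigO_one_of_mem_expansionRing {S : Set ℂ} {f : ℂ → ℂ} (hf : f ∈ expansionRing S) :
    f =O[𝓝[S] 0] (fun _ => (1 : ℂ)) :=
  let ⟨_, ha⟩ := mem_expansionRing.1 hf
  ha.isBigO_one

theorem expansionRing_congr {S : Set ℂ} {f g : ℂ → ℂ} (hf : f ∈ expansionRing S)
    (hfg : f =ᶠ[𝓝[S] 0] g) : g ∈ expansionRing S :=
  let ⟨a, ha⟩ := mem_expansionRing.1 hf
  mem_expansionRing.2 ⟨a, ha.congr hfg⟩

/-- Bounded solutions `x i = c i + ρ g i` of a system, where `g` is polynomial in `x` with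
coefficients in `expansionRing S`, are in `expansionRing S`. -/
theorem mem_expansionRing_of_system {S : Set ℂ} {ι : Type*} {x : ι → ℂ → ℂ}
    (hb : ∀ i, x i =O[𝓝[S] 0] (fun _ => (1 : ℂ)))
    (hx : ∀ i, ∃ c : ℂ, ∃ g ∈ Algebra.adjoin ℂ ((expansionRing S : Set (ℂ → ℂ)) ∪ Set.range x),
      x i =ᶠ[𝓝[S] 0] fun ρ => c + ρ * g ρ) (i : ι) : x i ∈ expansionRing S := by
  refine mem_expansionRing.2 (exists_hasScalarExpansion_of_mem_adjoin
    (T := (expansionRing S : Set (ℂ → ℂ)) ∪ Set.range x)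
    (Algebra.subset_adjoin (.inl (id_mem_expansionRing S))) ?_ ?_
    (Algebra.subset_adjoin (.inr ⟨i, rfl⟩)))
  · rintro f (hf | ⟨i, rfl⟩)
    · exact isBigO_one_of_mem_expansionRing hf
    · exact hb i
  · rintro f (hf | ⟨i, rfl⟩)
    · obtain ⟨a, ha⟩ := mem_expansionRing.1 hf
      obtain ⟨g, hg, hfg⟩ := ha.exists_shift
      exact ⟨a 0, g, Algebra.subset_adjoin (.inl (mem_expansionRing.2 ⟨_, hg⟩)), hfg⟩
    · exact hx i

theorem HasScalarExpansion.tendsto {S : Set ℂ} {f : ℂ → ℂ} {a : ℕ → ℂ}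
    (h : HasScalarExpansion S f a) : Tendsto f (𝓝[S] 0) (𝓝 (a 0)) := by
  have h0 : Tendsto (fun ρ : ℂ => ρ ^ 1) (𝓝[S] 0) (𝓝 0) := by
    simp only [pow_one]
    exact tendsto_id.mono_left nhdsWithin_le_nhds
  simpa [sub_eq_add_neg] using ((h 1).trans_tendsto h0).add_const (a 0)

/-- The inverse solves a system of the required kind: if $f = a_0 + \rho g$, then $f^{-1} = a_0^{-1}
- \rho\, a_0^{-1} g f^{-1}$, and $f^{-1}$ is bounded because $f$ has a non-zero limit. -/
theorem inv_mem_expansionRing {S : Set ℂ} {f : ℂ → ℂ} {c : ℂ} (hf : f ∈ expansionRing S)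
    (hc : c ≠ 0) (hfc : Tendsto f (𝓝[S] 0) (𝓝 c)) : f⁻¹ ∈ expansionRing S := by
  rcases (𝓝[S] (0 : ℂ)).eq_or_neBot with hbot | hne
  · exact mem_expansionRing.2 ⟨0, fun N => by simp [hbot]⟩
  obtain ⟨a, ha⟩ := mem_expansionRing.1 hf
  obtain rfl := tendsto_nhds_unique hfc ha.tendsto
  obtain ⟨g, hg, hfg⟩ := ha.exists_shift
  refine mem_expansionRing_of_system (ι := Unit) (x := fun _ => f⁻¹)
    (fun _ => (hfc.inv₀ hc).isBigO_one ℂ) (fun _ => ⟨(a 0)⁻¹, (-(a 0)⁻¹) • (g * f⁻¹),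
      Subalgebra.smul_mem _ (mul_mem (Algebra.subset_adjoin (.inl (mem_expansionRing.2 ⟨_, hg⟩)))
        (Algebra.subset_adjoin (.inr ⟨(), rfl⟩))) _, ?_⟩) ()
  filter_upwards [hfg, hfc.eventually_ne hc] with ρ h1 h2
  simp only [Pi.smul_apply, Pi.mul_apply, Pi.inv_apply, smul_eq_mul]
  field_simp
  rw [h1]; ring

/-! ### Matrix families with entries in a function algebra -/

variable {ι κ l : Type*}

/-- All entries of the matrix family `A` belong to `R`. -/
def EntriesIn (R : Subalgebra ℂ (ℂ → ℂ)) (A : ℂ → Matrix ι κ ℂ) : Prop :=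
  ∀ i j, (fun ρ => A ρ i j) ∈ R

namespace EntriesIn

variable {R : Subalgebra ℂ (ℂ → ℂ)}

theorem const (A : Matrix ι κ ℂ) : EntriesIn R fun _ => A := fun i j =>
  R.algebraMap_mem (A i j)

theorem add {A B : ℂ → Matrix ι κ ℂ} (hA : EntriesIn R A) (hB : EntriesIn R B) :
    EntriesIn R fun ρ => A ρ + B ρ := fun i j => R.add_mem (hA i j) (hB i j)

theorem sub {A B : ℂ → Matrix ι κ ℂ} (hA : EntriesIn R A) (hB : EntriesIn R B) :
    EntriesIn R fun ρ => A ρ - B ρ := fun i j => R.sub_mem (hA i j) (hB i j)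

theorem smul {f : ℂ → ℂ} {A : ℂ → Matrix ι κ ℂ} (hf : f ∈ R) (hA : EntriesIn R A) :
    EntriesIn R fun ρ => f ρ • A ρ := fun i j => R.mul_mem hf (hA i j)

theorem mul [Fintype κ] {A : ℂ → Matrix ι κ ℂ} {B : ℂ → Matrix κ l ℂ} (hA : EntriesIn R A)
    (hB : EntriesIn R B) : EntriesIn R fun ρ => A ρ * B ρ := fun i j => by
  have e : (fun ρ => (A ρ * B ρ) i j) = ∑ k, (fun ρ => A ρ i k) * fun ρ => B ρ k j := by
    ext ρ
    simp [Matrix.mul_apply]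
  rw [e]
  exact R.sum_mem fun k _ => R.mul_mem (hA i k) (hB k j)

theorem linearMap [Finite ι] [Finite κ] {ι' κ' : Type*} {A : ℂ → Matrix ι κ ℂ}
    (hA : EntriesIn R A) (L : Matrix ι κ ℂ →ₗ[ℂ] Matrix ι' κ' ℂ) :
    EntriesIn R fun ρ => L (A ρ) := fun i j => by
  classical
  cases nonempty_fintype ι
  cases nonempty_fintype κ
  have e : (fun ρ => L (A ρ) i j) = ∑ p : ι, ∑ q : κ,
      L (Matrix.single p q 1) i j • fun ρ => A ρ p q := by
    ext ρ
    conv_lhs => rw [Matrix.matrix_eq_sum_single (A ρ)]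
    simp only [map_sum, Matrix.sum_apply, Finset.sum_apply, Pi.smul_apply, smul_eq_mul]
    refine Finset.sum_congr rfl fun p _ => Finset.sum_congr rfl fun q _ => ?_
    rw [← mul_one (A ρ p q), ← smul_eq_mul, ← Matrix.smul_single, map_smul, Matrix.smul_apply,
      smul_eq_mul, smul_eq_mul, mul_one, mul_comm]
  rw [e]
  exact R.sum_mem fun p _ => R.sum_mem fun q _ => R.smul_mem (hA p q) _

theorem mono {R' : Subalgebra ℂ (ℂ → ℂ)} {A : ℂ → Matrix ι κ ℂ} (hA : EntriesIn R A)
    (h : R ≤ R') : EntriesIn R' A := fun i j => h (hA i j)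

theorem det [Fintype ι] [DecidableEq ι] {A : ℂ → Matrix ι ι ℂ} (hA : EntriesIn R A) :
    (fun ρ => (A ρ).det) ∈ R := by
  have e : (fun ρ => (A ρ).det) = ∑ σ : Equiv.Perm ι,
      ((Equiv.Perm.sign σ : ℤ) : ℂ) • ∏ i, fun ρ => A ρ (σ i) i := by
    ext ρ
    simp [Matrix.det_apply', Finset.prod_apply]
  rw [e]
  exact R.sum_mem fun σ _ => R.smul_mem (R.prod_mem fun i _ => hA _ _) _

theorem adjugate [Fintype ι] [DecidableEq ι] {A : ℂ → Matrix ι ι ℂ} (hA : EntriesIn R A) :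
    EntriesIn R fun ρ => (A ρ).adjugate := fun i j => by
  simp only [Matrix.adjugate_apply]
  refine det fun p q => ?_
  by_cases hp : p = j
  · subst hp
    simp only [Matrix.updateRow_self]
    exact R.algebraMap_mem (Pi.single (M := fun _ => ℂ) i 1 q)
  · simpa only [Matrix.updateRow_ne hp] using hA p q

theorem inv {S : Set ℂ} [Fintype ι] [DecidableEq ι] {A : ℂ → Matrix ι ι ℂ}
    (hA : EntriesIn (expansionRing S) A) {A₀ : Matrix ι ι ℂ} (h0 : A₀.det ≠ 0)
    (hlim : Tendsto A (𝓝[S] 0) (𝓝 A₀)) : EntriesIn (expansionRing S) fun ρ => (A ρ)⁻¹ := by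
  have hd : Tendsto (fun ρ => (A ρ).det) (𝓝[S] 0) (𝓝 A₀.det) :=
    ((Continuous.matrix_det continuous_id).tendsto A₀).comp hlim
  have := smul (inv_mem_expansionRing hA.det h0 hd) hA.adjugate
  simpa only [Matrix.inv_def, Ring.inverse_eq_inv', Pi.inv_apply] using this

end EntriesIn

/-! ### A quadratic matrix equation with a small parameter -/

/-- For small $\rho$ the right-hand side is a $\tfrac12$-contraction of the closed unit ball. The
threshold depends only on `Λ` and `K`, so it is uniform along a bounded family of coefficients. -/
theorem exists_fixedPoint_quadratic {𝔸 : Type*} [NormedRing 𝔸] [NormedAlgebra ℂ 𝔸]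
    [CompleteSpace 𝔸] (Λ : 𝔸 →L[ℂ] 𝔸) (K : ℝ) :
    ∃ ε > 0, ∀ (ρ : ℂ) (U V : 𝔸), ‖ρ‖ < ε → ‖U‖ ≤ K → ‖V‖ ≤ K →
      ∃ X : 𝔸, ‖X‖ ≤ 1 ∧ X = ρ • Λ (U + V * X - X * V - X * U * X) := by
  refine ⟨1 / (8 * (‖Λ‖ + 1) * (|K| + 1)), by positivity, fun ρ U V hρ hU hV => ?_⟩
  have hK : K ≤ |K| := le_abs_self K
  -- The factor 4 counts the terms in the Lipschitz estimate: two from the commutator with `V`, two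
  -- from the quadratic term.
  have hρ' : ‖ρ‖ * (‖Λ‖ * (4 * |K|)) ≤ 1 / 2 := by
    rw [lt_div_iff₀ (by positivity)] at hρ
    have : ‖ρ‖ * (‖Λ‖ * (4 * |K|)) ≤ ‖ρ‖ * ((‖Λ‖ + 1) * (4 * (|K| + 1))) := by
      gcongr <;> linarith
    nlinarith
  set F : 𝔸 → 𝔸 := fun X => ρ • Λ (U + V * X - X * V - X * U * X) with hF
  have hU' : ‖U‖ ≤ |K| := hU.trans hK
  have hV' : ‖V‖ ≤ |K| := hV.trans hK
  have hFn : ∀ Z (c : ℝ), ‖Z‖ ≤ 4 * |K| * c → 0 ≤ c → ‖ρ • Λ Z‖ ≤ 1 / 2 * c := by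
    intro Z c hZ hc
    calc ‖ρ • Λ Z‖ ≤ ‖ρ‖ * (‖Λ‖ * ‖Z‖) := by rw [norm_smul]; gcongr; exact Λ.le_opNorm Z
      _ ≤ ‖ρ‖ * (‖Λ‖ * (4 * |K| * c)) := by gcongr
      _ = ‖ρ‖ * (‖Λ‖ * (4 * |K|)) * c := by ring
      _ ≤ _ := by gcongr
  have hlip : ∀ X Y : 𝔸, ‖X‖ ≤ 1 → ‖Y‖ ≤ 1 → ‖F X - F Y‖ ≤ 1 / 2 * ‖X - Y‖ := by
    intro X Y hX hY
    have e : F X - F Y = ρ • Λ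
        (V * (X - Y) - (X - Y) * V - ((X - Y) * U * X + Y * U * (X - Y))) := by
      rw [hF, ← smul_sub, ← map_sub]
      congr 2
      noncomm_ring
    rw [e]
    refine hFn _ _ ?_ (norm_nonneg _)
    have h1 : ‖V * (X - Y)‖ ≤ |K| * ‖X - Y‖ := (norm_mul_le _ _).trans (by gcongr)
    have h2 : ‖(X - Y) * V‖ ≤ ‖X - Y‖ * |K| := (norm_mul_le _ _).trans (by gcongr)
    have h3 : ‖(X - Y) * U * X‖ ≤ ‖X - Y‖ * |K| * 1 :=
      (norm_mul₃_le).trans (by gcongr)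
    have h4 : ‖Y * U * (X - Y)‖ ≤ 1 * |K| * ‖X - Y‖ :=
      (norm_mul₃_le).trans (by gcongr)
    have h5 := norm_sub_le (V * (X - Y) - (X - Y) * V) ((X - Y) * U * X + Y * U * (X - Y))
    have h6 := norm_sub_le (V * (X - Y)) ((X - Y) * V)
    have h7 := norm_add_le ((X - Y) * U * X) (Y * U * (X - Y))
    linarith
  have hzero : ‖F 0‖ ≤ 1 / 2 := by
    have := hFn U 1 (by linarith [abs_nonneg K]) zero_le_one
    simpa [hF] using this
  have hmaps : Set.MapsTo F (Metric.closedBall 0 1) (Metric.closedBall 0 1) := by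
    intro X hX
    rw [mem_closedBall_zero_iff] at hX ⊢
    have h1 := hlip X 0 hX (by simp)
    rw [sub_zero] at h1
    have h2 := norm_add_le (F X - F 0) (F 0)
    rw [sub_add_cancel] at h2
    linarith
  have hc : ContractingWith (1 / 2) (hmaps.restrict F _ _) := by
    refine ⟨by rw [← NNReal.coe_lt_coe]; norm_num, LipschitzWith.of_dist_le_mul fun X Y => ?_⟩
    have hX := mem_closedBall_zero_iff.1 X.2
    have hY := mem_closedBall_zero_iff.1 Y.2
    have := hlip X Y hX hY
    rw [Subtype.dist_eq, Subtype.dist_eq, dist_eq_norm, dist_eq_norm]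
    simpa using this
  obtain ⟨X, hX, hfix, -⟩ := hc.exists_fixedPoint' Metric.isClosed_closedBall.isComplete hmaps
    (Metric.mem_closedBall_self zero_le_one) (edist_ne_top _ _)
  exact ⟨X, mem_closedBall_zero_iff.1 hX, hfix.symm⟩

section

variable [Fintype ι] [DecidableEq ι]

attribute [local instance] Matrix.linftyOpNormedRing Matrix.linftyOpNormedAlgebra

theorem norm_entry_le_linfty_opNorm (A : Matrix ι ι ℂ) (i j : ι) : ‖A i j‖ ≤ ‖A‖ := by
  have h : ‖A i j‖₊ ≤ ‖A‖₊ := by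
    rw [Matrix.linfty_opNNNorm_def]
    exact (Finset.single_le_sum (f := fun j => ‖A i j‖₊) (fun _ _ => zero_le)
      (Finset.mem_univ j)).trans (Finset.le_sup (f := fun i => ∑ j, ‖A i j‖₊) (Finset.mem_univ i))
  exact_mod_cast h

theorem exists_eventually_norm_le {S : Set ℂ} {A : ℂ → Matrix ι ι ℂ}
    (hA : EntriesIn (expansionRing S) A) : ∃ K : ℝ, ∀ᶠ ρ in 𝓝[S] 0, ‖A ρ‖ ≤ K := by
  have h : ∀ i j, ∃ C : ℝ, ∀ᶠ ρ in 𝓝[S] 0, ‖A ρ i j‖ ≤ C := fun i j => by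
    simpa using (isBigO_one_of_mem_expansionRing (hA i j)).bound
  choose C hC using h
  refine ⟨∑ i, ∑ j, C i j * ‖Matrix.single i j (1 : ℂ)‖, ?_⟩
  filter_upwards [eventually_all.2 fun i => eventually_all.2 fun j => hC i j] with ρ hρ
  rw [Matrix.matrix_eq_sum_single (A ρ)]
  refine (norm_sum_le _ _).trans (Finset.sum_le_sum fun i _ => (norm_sum_le _ _).trans
    (Finset.sum_le_sum fun j _ => ?_))
  rw [← mul_one (A ρ i j), ← smul_eq_mul, ← Matrix.smul_single, norm_smul]
  exact mul_le_mul_of_nonneg_right (hρ i j) (norm_nonneg _)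

/-- The quadratic equation `X = ρ Λ(U + VX - XV - XUX)` has a solution with a full expansion. -/
theorem exists_entriesIn_quadratic {S : Set ℂ} {U V : ℂ → Matrix ι ι ℂ}
    (hU : EntriesIn (expansionRing S) U) (hV : EntriesIn (expansionRing S) V)
    (Λ : Matrix ι ι ℂ →ₗ[ℂ] Matrix ι ι ℂ) :
    ∃ X : ℂ → Matrix ι ι ℂ, EntriesIn (expansionRing S) X ∧ Tendsto X (𝓝[S] 0) (𝓝 0) ∧
      ∀ᶠ ρ in 𝓝[S] 0, X ρ = ρ • Λ (U ρ + V ρ * X ρ - X ρ * V ρ - X ρ * U ρ * X ρ) := by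
  classical
  obtain ⟨K₁, hK₁⟩ := exists_eventually_norm_le hU
  obtain ⟨K₂, hK₂⟩ := exists_eventually_norm_le hV
  obtain ⟨ε, hε, hfix⟩ :=
    exists_fixedPoint_quadratic (LinearMap.toContinuousLinearMap Λ) (max K₁ K₂)
  have hsmall : ∀ᶠ ρ in 𝓝[S] (0 : ℂ), ‖ρ‖ < ε := by
    filter_upwards [nhdsWithin_le_nhds (Metric.ball_mem_nhds (0 : ℂ) hε)] with ρ hρ
    exact mem_ball_zero_iff.1 hρ
  have hex : ∀ᶠ ρ in 𝓝[S] (0 : ℂ), ∃ X : Matrix ι ι ℂ,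
      ‖X‖ ≤ 1 ∧ X = ρ • Λ (U ρ + V ρ * X - X * V ρ - X * U ρ * X) := by
    filter_upwards [hK₁, hK₂, hsmall] with ρ h1 h2 h3
    exact hfix ρ _ _ h3 (h1.trans (le_max_left _ _)) (h2.trans (le_max_right _ _))
  -- The solution is chosen separately for each $\rho$; boundedness alone will give the expansion.
  obtain ⟨X, hX⟩ : ∃ X : ℂ → Matrix ι ι ℂ, ∀ᶠ ρ in 𝓝[S] (0 : ℂ),
      ‖X ρ‖ ≤ 1 ∧ X ρ = ρ • Λ (U ρ + V ρ * X ρ - X ρ * V ρ - X ρ * U ρ * X ρ) := by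
    refine ⟨fun ρ => if h : ∃ X : Matrix ι ι ℂ, ‖X‖ ≤ 1 ∧
      X = ρ • Λ (U ρ + V ρ * X - X * V ρ - X * U ρ * X) then Classical.choose h else 0,
      hex.mono fun ρ h => ?_⟩
    simp only [dif_pos h]
    exact Classical.choose_spec h
  have hbdd : ∀ i j, (fun ρ => X ρ i j) =O[𝓝[S] 0] (fun _ => (1 : ℂ)) := fun i j => by
    refine IsBigO.of_bound 1 ?_
    filter_upwards [hX] with ρ hρ
    simpa using (norm_entry_le_linfty_opNorm _ i j).trans hρ.1
  have hXmem : EntriesIn (expansionRing S) X := fun i j => by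
    refine mem_expansionRing_of_system (x := fun (p : ι × ι) ρ => X ρ p.1 p.2)
      (fun p => hbdd p.1 p.2) (fun p => ?_) (i, j)
    set R := Algebra.adjoin ℂ ((expansionRing S : Set (ℂ → ℂ)) ∪
      Set.range fun (p : ι × ι) ρ => X ρ p.1 p.2)
    have hle : expansionRing S ≤ R := fun f hf => Algebra.subset_adjoin (.inl hf)
    have hXR : EntriesIn R X := fun i j => Algebra.subset_adjoin (.inr ⟨(i, j), rfl⟩)
    have hU' := hU.mono hle
    have hV' := hV.mono hle
    have := ((((hU'.add (hV'.mul hXR)).sub (hXR.mul hV')).sub ((hXR.mul hU').mul hXR)).linearMap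
      Λ) p.1 p.2
    refine ⟨0, _, this, ?_⟩
    filter_upwards [hX] with ρ hρ
    conv_lhs => rw [hρ.2]
    simp
  refine ⟨X, hXmem, ?_, hX.mono fun ρ hρ => hρ.2⟩
  -- Since $X$ is $\rho$ times a bounded family, it tends to zero.
  obtain ⟨K, hK⟩ := exists_eventually_norm_le ((((hU.add (hV.mul hXmem)).sub (hXmem.mul hV)).sub
    ((hXmem.mul hU).mul hXmem)).linearMap Λ)
  have hid : Tendsto (fun ρ : ℂ => ‖ρ‖ * K) (𝓝[S] 0) (𝓝 0) := by
    simpa using (((continuous_norm.tendsto (0 : ℂ)).mono_left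
      (nhdsWithin_le_nhds (s := S))).mul_const K)
  refine squeeze_zero_norm' ?_ hid
  filter_upwards [hX, hK] with ρ h1 h2
  rw [h1.2, norm_smul]
  gcongr

end

/-! ### Jordan form of nilpotent matrices and the Fitting decomposition -/

section LinearAlgebra

open Polynomial in
-- The basis is that of the powers of `X` in descending order, $b_j = X^{k-1-j}$, so that
-- multiplication by `X` lowers the index and its matrix has ones above the diagonal.
theorem exists_basis_quotient_X_pow (k : ℕ) :
    ∃ b : Module.Basis (Fin k) ℂ (ℂ[X] ⧸ Submodule.span ℂ[X] {(X : ℂ[X]) ^ k}),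
      ∀ j : Fin k, ((j : ℕ) = 0 → (X : ℂ[X]) • b j = 0) ∧
        ∀ i : Fin k, (j : ℕ) = i + 1 → (X : ℂ[X]) • b j = b i := by
  set pb := AdjoinRoot.powerBasis' (monic_X_pow (R := ℂ) k) with hpb
  have hdim : pb.dim = k := natDegree_X_pow k
  let b : Module.Basis (Fin k) ℂ (ℂ[X] ⧸ Submodule.span ℂ[X] {(X : ℂ[X]) ^ k}) :=
    pb.basis.reindex ((finCongr hdim).trans Fin.revPerm)
  have hb : ∀ j : Fin k, b j = Submodule.Quotient.mk ((X : ℂ[X]) ^ (k - 1 - (j : ℕ))) := by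
    intro j
    have h1 : b j = AdjoinRoot.root (X ^ k : ℂ[X]) ^ (k - 1 - (j : ℕ)) := by
      have : b j = pb.basis (((finCongr hdim).trans Fin.revPerm).symm j) :=
        Module.Basis.reindex_apply pb.basis _ _
      rw [this, pb.basis_eq_pow]
      have h2 : pb.gen = AdjoinRoot.root (X ^ k : ℂ[X]) := rfl
      rw [h2]
      congr 1
      simp [Fin.val_rev]
      omega
    rw [h1, ← AdjoinRoot.mk_X, ← map_pow]
    rfl
  have hX : ∀ n : ℕ, (X : ℂ[X]) • (Submodule.Quotient.mk ((X : ℂ[X]) ^ n) :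
      ℂ[X] ⧸ Submodule.span ℂ[X] {(X : ℂ[X]) ^ k}) = Submodule.Quotient.mk (X ^ (n + 1)) := by
    intro n
    rw [← Submodule.Quotient.mk_smul, smul_eq_mul, pow_succ']
  refine ⟨b, fun j => ⟨fun hj => ?_, fun i hj => ?_⟩⟩
  · rw [hb, hX, Submodule.Quotient.mk_eq_zero, hj]
    have : k - 1 - 0 + 1 = k := by have := j.2; omega
    rw [this]
    exact Submodule.mem_span_singleton_self _
  · rw [hb, hb, hX]
    have : k - 1 - (j : ℕ) + 1 = k - 1 - (i : ℕ) := by have := j.2; omega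
    rw [this]

/-- The Jordan normal form of a nilpotent endomorphism. -/
theorem exists_basis_isJordanType {V : Type*} [AddCommGroup V] [Module ℂ V]
    [FiniteDimensional ℂ V] (f : Module.End ℂ V) (hf : IsNilpotent f) :
    ∃ (n : ℕ) (b : Module.Basis (Fin n) ℂ V), IsJordanType (LinearMap.toMatrix b b f) := by
  classical
  obtain ⟨r, hr⟩ := hf
  have htors : Module.IsTorsion' (Module.AEval' f)
      (Submonoid.powers (Polynomial.X : Polynomial ℂ)) := by
    intro x
    refine ⟨⟨Polynomial.X ^ r, r, rfl⟩, ?_⟩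
    obtain ⟨v, rfl⟩ := (Module.AEval'.of f).surjective x
    change (Polynomial.X ^ r : Polynomial ℂ) • Module.AEval'.of f v = 0
    rw [Module.AEval'.X_pow_smul_of, hr]
    simp
  -- As a $\mathbb C[X]$-module with `X` acting by `f`, the space is `X`-power torsion, hence a
  -- direct sum of modules $\mathbb C[X]/(X^{k_i})$; each summand yields one Jordan chain.
  obtain ⟨d, k, ⟨e⟩⟩ := Module.torsion_by_prime_power_decomposition
    (Polynomial.irreducible_X (R := ℂ)) htors
  choose bq hbq using exists_basis_quotient_X_pow
  let bD : Module.Basis (Σ i : Fin d, Fin (k i)) ℂ (DirectSum (Fin d) fun i =>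
    Polynomial ℂ ⧸ Submodule.span (Polynomial ℂ) {(Polynomial.X : Polynomial ℂ) ^ (k i)}) :=
    DFinsupp.basis fun i => bq (k i)
  have hbD : ∀ p, bD p = DirectSum.lof (Polynomial ℂ) (Fin d) (fun i =>
      Polynomial ℂ ⧸ Submodule.span (Polynomial ℂ) {(Polynomial.X : Polynomial ℂ) ^ (k i)})
        p.1 (bq (k p.1) p.2) := by
    intro p
    refine Module.Basis.apply_eq_iff.2 ?_
    ext ⟨i', j'⟩
    obtain ⟨i, j⟩ := p
    change (bq (k i')).repr ((DirectSum.lof (Polynomial ℂ) (Fin d) (fun i =>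
      Polynomial ℂ ⧸ Submodule.span (Polynomial ℂ) {(Polynomial.X : Polynomial ℂ) ^ (k i)})
        i (bq (k i) j)) i') j' = _
    by_cases hi : i = i'
    · subst hi
      simp [DirectSum.lof_apply, Finsupp.single_apply]
    · rw [DirectSum.lof_eq_of, DirectSum.of_eq_of_ne _ _ _ (Ne.symm hi), map_zero,
        Finsupp.single_eq_of_ne (by grind)]
      rfl
  let b' : Module.Basis (Σ i : Fin d, Fin (k i)) ℂ V :=
    bD.map ((e.restrictScalars ℂ).symm.trans (Module.AEval'.of f).symm)
  have hb' : ∀ p, f (b' p) = (Module.AEval'.of f).symm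
      (e.symm (DirectSum.lof (Polynomial ℂ) (Fin d) (fun i =>
      Polynomial ℂ ⧸ Submodule.span (Polynomial ℂ) {(Polynomial.X : Polynomial ℂ) ^ (k i)})
        p.1 ((Polynomial.X : Polynomial ℂ) • bq (k p.1) p.2))) := by
    intro p
    have : b' p = (Module.AEval'.of f).symm (e.symm (bD p)) := rfl
    rw [this, hbD, ← Module.AEval'.of_symm_X_smul, ← map_smul, ← map_smul]
  have h0 : ∀ (i : Fin d) (j : Fin (k i)), (j : ℕ) = 0 → f (b' ⟨i, j⟩) = 0 := by
    intro i j hj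
    rw [hb', (hbq (k i) j).1 hj]
    simp
  have h1 : ∀ (i : Fin d) (j j' : Fin (k i)), (j : ℕ) = j' + 1 → f (b' ⟨i, j⟩) = b' ⟨i, j'⟩ := by
    intro i j j' hj
    rw [hb', (hbq (k i) j).2 j' hj]
    have : b' ⟨i, j'⟩ = (Module.AEval'.of f).symm (e.symm (bD ⟨i, j'⟩)) := rfl
    rw [this, hbD]
  -- `finSigmaFinEquiv` keeps each chain in consecutive positions, so neighbours in a chain stay on
  -- the first superdiagonal.
  refine ⟨_, b'.reindex finSigmaFinEquiv, fun q p => ?_⟩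
  obtain ⟨⟨i, j⟩, rfl⟩ := finSigmaFinEquiv.surjective p
  rw [LinearMap.toMatrix_apply, Module.Basis.reindex_apply, Equiv.symm_apply_apply]
  rcases Nat.eq_zero_or_pos (j : ℕ) with hj | hj
  · left
    simp [h0 i j hj]
  · have hlt : (j : ℕ) - 1 < k i := by have := j.2; omega
    have hj' : (j : ℕ) = ((⟨j - 1, hlt⟩ : Fin (k i)) : ℕ) + 1 := by simp; omega
    rw [h1 i j ⟨j - 1, hlt⟩ hj']
    by_cases hq : q = finSigmaFinEquiv ⟨i, ⟨j - 1, hlt⟩⟩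
    · right
      subst hq
      refine ⟨by simp, ?_⟩
      rw [finSigmaFinEquiv_apply, finSigmaFinEquiv_apply]
      simp only
      omega
    · left
      rw [Module.Basis.repr_reindex_apply, Module.Basis.repr_self, Finsupp.single_apply,
        if_neg]
      rintro h
      exact hq (by rw [h, Equiv.apply_symm_apply])

theorem exists_matrix_of_basis {ι κ : Type*} [Fintype ι] [DecidableEq ι] [Fintype κ]
    [DecidableEq κ] (b : Module.Basis κ ℂ (ι → ℂ)) (N : Matrix ι ι ℂ) :
    ∃ (P : Matrix ι κ ℂ) (P' : Matrix κ ι ℂ), P * P' = 1 ∧ P' * P = 1 ∧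
      P' * N * P = LinearMap.toMatrix b b (Matrix.toLin' N) := by
  refine ⟨(Pi.basisFun ℂ ι).toMatrix b, b.toMatrix (Pi.basisFun ℂ ι),
    Module.Basis.toMatrix_mul_toMatrix_flip _ _, Module.Basis.toMatrix_mul_toMatrix_flip _ _, ?_⟩
  rw [← basis_toMatrix_mul_linearMap_toMatrix_mul_basis_toMatrix b (Pi.basisFun ℂ ι) b
    (Pi.basisFun ℂ ι) (Matrix.toLin' N)]
  congr 2
  rw [LinearMap.toMatrix_eq_toMatrix', LinearMap.toMatrix'_toLin']

theorem Matrix.exists_isJordanType_of_isNilpotent {ι : Type*} [Fintype ι] [DecidableEq ι]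
    (N : Matrix ι ι ℂ) (hN : IsNilpotent N) :
    ∃ (n : ℕ) (P : Matrix ι (Fin n) ℂ) (P' : Matrix (Fin n) ι ℂ), P * P' = 1 ∧ P' * P = 1 ∧
      IsJordanType (P' * N * P) := by
  obtain ⟨n, b, hb⟩ := exists_basis_isJordanType (Matrix.toLin' N)
    (hN.map (Matrix.toLinAlgEquiv' (R := ℂ) (n := ι)))
  obtain ⟨P, P', h1, h2, h3⟩ := exists_matrix_of_basis b N
  exact ⟨n, P, P', h1, h2, h3 ▸ hb⟩

/-- The Fitting decomposition of a singular, non-nilpotent matrix. -/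
theorem Matrix.exists_fitting {ι : Type*} [Fintype ι] [DecidableEq ι]
    (N : Matrix ι ι ℂ) (hdet : N.det = 0) (hN : ¬ IsNilpotent N) :
    ∃ (r s : ℕ) (P : Matrix ι (Fin r ⊕ Fin s) ℂ) (P' : Matrix (Fin r ⊕ Fin s) ι ℂ)
      (N₁ : Matrix (Fin r) (Fin r) ℂ) (N₂ : Matrix (Fin s) (Fin s) ℂ),
      P * P' = 1 ∧ P' * P = 1 ∧ P' * N * P = Matrix.fromBlocks N₁ 0 0 N₂ ∧
      IsNilpotent N₁ ∧ IsUnit N₂ ∧ r < Fintype.card ι ∧ s < Fintype.card ι := by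
  classical
  set f : Module.End ℂ (ι → ℂ) := Matrix.toLin' N with hf
  have hfnil : ¬ IsNilpotent f := fun h => hN <| by
    have := h.map (Matrix.toLinAlgEquiv' (R := ℂ) (n := ι)).symm
    have e : (Matrix.toLinAlgEquiv' (R := ℂ) (n := ι)).symm (Matrix.toLin' N) = N :=
      LinearMap.toMatrix'_toLin' N
    rwa [hf, e] at this
  -- For large $n$ the space is $\ker f^n \oplus \operatorname{range} f^n$. The condition $n \ge 1$
  -- ensures $\ker f \subseteq \ker f^n$, which gives injectivity of `f` on the range and a non-zero
  -- kernel part.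
  obtain ⟨n, hn, hpos⟩ :=
    (f.eventually_isCompl_ker_pow_range_pow.and (eventually_ge_atTop 1)).exists
  set K := LinearMap.ker (f ^ n)
  set R := LinearMap.range (f ^ n)
  have hcomm : ∀ x, (f ^ n) (f x) = f ((f ^ n) x) := fun x => by
    rw [← Module.End.mul_apply, ← Module.End.mul_apply, ← pow_succ, pow_succ']
  have hK : ∀ x ∈ K, f x ∈ K := fun x hx => by
    rw [LinearMap.mem_ker] at hx ⊢
    rw [hcomm, hx, map_zero]
  have hR : ∀ x ∈ R, f x ∈ R := by
    rintro _ ⟨y, rfl⟩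
    exact ⟨f y, hcomm y⟩
  let e := Submodule.prodEquivOfIsCompl K R hn
  let bK := Module.finBasis ℂ K
  let bR := Module.finBasis ℂ R
  have hfe : f ∘ₗ e.toLinearMap = e.toLinearMap ∘ₗ ((f.restrict hK).prodMap (f.restrict hR)) := by
    ext x <;> simp [e]
  obtain ⟨P, P', h1, h2, h3⟩ := exists_matrix_of_basis ((bK.prod bR).map e) N
  have hsum := Submodule.finrank_add_eq_of_isCompl hn
  rw [Module.finrank_fintype_fun_eq_card] at hsum
  refine ⟨_, _, P, P', LinearMap.toMatrix bK bK (f.restrict hK),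
    LinearMap.toMatrix bR bR (f.restrict hR), h1, h2, ?_, ?_, ?_, ?_, ?_⟩
  · rw [h3, ← LinearMap.toMatrix_prodMap]
    ext i j
    simp only [LinearMap.toMatrix_apply, Module.Basis.map_apply, Module.Basis.map_repr,
      LinearEquiv.trans_apply]
    have := LinearMap.congr_fun hfe (bK.prod bR j)
    simp only [LinearMap.comp_apply, LinearEquiv.coe_coe] at this
    rw [← hf, this, e.symm_apply_apply]
  · have : IsNilpotent (f.restrict hK) := ⟨n, by
      ext x
      rw [Module.End.pow_restrict _ hK]
      simp⟩
    exact this.map (LinearMap.toMatrixAlgEquiv bK)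
  · have : IsUnit (f.restrict hR) := by
      rw [LinearMap.isUnit_iff_ker_eq_bot, LinearMap.ker_eq_bot']
      intro x hx
      have hx' : f x = 0 := congrArg Subtype.val hx
      have hmem : (x : ι → ℂ) ∈ K := by
        obtain ⟨n, rfl⟩ := Nat.exists_eq_add_of_le' hpos
        simp [K, LinearMap.mem_ker, pow_succ, hx']
      exact Subtype.ext (Submodule.disjoint_def.1 hn.disjoint _ hmem x.2)
    exact this.map (LinearMap.toMatrixAlgEquiv bR)
  · have : 0 < Module.finrank ℂ R := by
      rw [Nat.pos_iff_ne_zero]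
      intro h
      exact hfnil ⟨n, LinearMap.range_eq_bot.1 (Submodule.finrank_eq_zero.1 h)⟩
    omega
  · have : 0 < Module.finrank ℂ K := by
      rw [Nat.pos_iff_ne_zero]
      intro h
      obtain ⟨v, hv, hv0⟩ := Matrix.exists_mulVec_eq_zero_iff.2 hdet
      have hmem : v ∈ K := by
        obtain ⟨n, rfl⟩ := Nat.exists_eq_add_of_le' hpos
        simp [K, LinearMap.mem_ker, pow_succ, hf, hv0]
      rw [Submodule.finrank_eq_zero.1 h] at hmem
      exact hv (by simpa using hmem)
    omega

end LinearAlgebra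

/-! ### Sylvester equations and decoupling of blocks -/

section Sylvester

variable {ι κ : Type*} [Fintype ι] [DecidableEq ι] [Fintype κ] [DecidableEq κ]

/-- Iterating the relation gives $UT^n = N^nU$, which vanishes for large $n$, and $T^n$ can be
cancelled. -/
theorem Matrix.eq_zero_of_mul_eq_mul_of_isNilpotent {N : Matrix ι ι ℂ} {T : Matrix κ κ ℂ}
    (hN : IsNilpotent N) (hT : IsUnit T) {U : Matrix ι κ ℂ} (h : U * T = N * U) : U = 0 := by
  obtain ⟨n, hn⟩ := hN
  have hpow : ∀ k : ℕ, U * T ^ k = N ^ k * U := fun k => by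
    induction k with
    | zero => simp
    | succ k ih =>
      rw [pow_succ', ← Matrix.mul_assoc, h, Matrix.mul_assoc, ih, ← Matrix.mul_assoc, pow_succ']
  have h0 := hpow n
  rw [hn, Matrix.zero_mul] at h0
  have hdet := (Matrix.isUnit_iff_isUnit_det _).1 (hT.pow n)
  rw [← Matrix.mul_nonsing_inv_cancel_right (T ^ n) U hdet, h0, Matrix.zero_mul]

theorem Matrix.eq_zero_of_mul_eq_mul_of_isNilpotent' {N : Matrix ι ι ℂ} {T : Matrix κ κ ℂ}
    (hN : IsNilpotent N) (hT : IsUnit T) {U : Matrix κ ι ℂ} (h : U * N = T * U) : U = 0 := by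
  have hN' : IsNilpotent N.transpose := by
    obtain ⟨n, hn⟩ := hN
    exact ⟨n, by rw [← Matrix.transpose_pow, hn, Matrix.transpose_zero]⟩
  have hT' : IsUnit T.transpose := by
    rwa [Matrix.isUnit_iff_isUnit_det, Matrix.det_transpose, ← Matrix.isUnit_iff_isUnit_det]
  have := eq_zero_of_mul_eq_mul_of_isNilpotent hN' hT' (U := U.transpose)
    (by rw [← Matrix.transpose_mul, ← Matrix.transpose_mul, h])
  simpa using this

omit [DecidableEq ι] [DecidableEq κ] in
/-- A linear right inverse of `U ↦ U * Q - P * U`, if this map is injective. -/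
theorem exists_sylvester_rightInverse (P : Matrix ι ι ℂ) (Q : Matrix κ κ ℂ)
    (h : ∀ U : Matrix ι κ ℂ, U * Q = P * U → U = 0) :
    ∃ Λ : Matrix ι κ ℂ →ₗ[ℂ] Matrix ι κ ℂ, ∀ Z, Λ Z * Q - P * Λ Z = Z := by
  let L : Matrix ι κ ℂ →ₗ[ℂ] Matrix ι κ ℂ :=
    { toFun := fun U => U * Q - P * U
      map_add' := fun U V => by rw [Matrix.add_mul, Matrix.mul_add]; abel
      map_smul' := fun c U => by simp [smul_sub] }
  have hL : Function.Injective L :=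
    (injective_iff_map_eq_zero L).2 fun U hU => h U (sub_eq_zero.1 hU)
  let e := LinearEquiv.ofInjectiveEndo L hL
  exact ⟨e.symm.toLinearMap, fun Z => e.apply_symm_apply Z⟩

/-- Block-diagonalization of a perturbation of a block-diagonal matrix whose blocks have disjoint
spectra. -/
theorem exists_blockDiagonalization {S : Set ℂ} {P : Matrix ι ι ℂ} {Q : Matrix κ κ ℂ}
    (h₁ : ∀ U : Matrix ι κ ℂ, U * Q = P * U → U = 0)
    (h₂ : ∀ U : Matrix κ ι ℂ, U * P = Q * U → U = 0)
    {C : ℂ → Matrix (ι ⊕ κ) (ι ⊕ κ) ℂ} (hC : EntriesIn (expansionRing S) C) :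
    ∃ (X : ℂ → Matrix (ι ⊕ κ) (ι ⊕ κ) ℂ) (D₁ : ℂ → Matrix ι ι ℂ) (D₂ : ℂ → Matrix κ κ ℂ),
      EntriesIn (expansionRing S) X ∧ EntriesIn (expansionRing S) D₁ ∧
      EntriesIn (expansionRing S) D₂ ∧ Tendsto X (𝓝[S] 0) (𝓝 0) ∧
      ∀ᶠ ρ in 𝓝[S] 0, (Matrix.fromBlocks P 0 0 Q + ρ • C ρ) * (1 + X ρ) =
        (1 + X ρ) * Matrix.fromBlocks (D₁ ρ) 0 0 (D₂ ρ) := by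
  obtain ⟨Λ₁, hΛ₁⟩ := exists_sylvester_rightInverse P Q h₁
  obtain ⟨Λ₂, hΛ₂⟩ := exists_sylvester_rightInverse Q P h₂
  let Λ : Matrix (ι ⊕ κ) (ι ⊕ κ) ℂ →ₗ[ℂ] Matrix (ι ⊕ κ) (ι ⊕ κ) ℂ :=
    { toFun := fun Z => Matrix.fromBlocks 0 (Λ₁ Z.toBlocks₁₂) (Λ₂ Z.toBlocks₂₁) 0
      map_add' := fun Y Z => by
        rw [Matrix.fromBlocks_add, ← map_add, ← map_add, add_zero, add_zero]
        rfl
      map_smul' := fun c Z => by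
        rw [RingHom.id_apply, Matrix.fromBlocks_smul, ← map_smul, ← map_smul, smul_zero, smul_zero]
        rfl }
  let c₁₁ := fun ρ => (C ρ).toBlocks₁₁
  let c₁₂ := fun ρ => (C ρ).toBlocks₁₂
  let c₂₁ := fun ρ => (C ρ).toBlocks₂₁
  let c₂₂ := fun ρ => (C ρ).toBlocks₂₂
  have hCb : ∀ ρ, C ρ = Matrix.fromBlocks (c₁₁ ρ) (c₁₂ ρ) (c₂₁ ρ) (c₂₂ ρ) := fun ρ =>
    (Matrix.fromBlocks_toBlocks (C ρ)).symm
  have hU : EntriesIn (expansionRing S) fun ρ => Matrix.fromBlocks 0 (c₁₂ ρ) (c₂₁ ρ) 0 := by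
    rintro (i | i) (j | j)
    · exact zero_mem _
    · exact hC _ _
    · exact hC _ _
    · exact zero_mem _
  have hV : EntriesIn (expansionRing S) fun ρ => Matrix.fromBlocks (c₁₁ ρ) 0 0 (c₂₂ ρ) := by
    rintro (i | i) (j | j)
    · exact hC _ _
    · exact zero_mem _
    · exact zero_mem _
    · exact hC _ _
  -- With `U` the off-diagonal and `V` the diagonal part of `C`, the Riccati equations of both
  -- off-diagonal blocks are packed into one quadratic equation. The values of `Λ` are off-diagonal,
  -- and so is the solution.
  obtain ⟨X, hX, hX0, hXeq⟩ := exists_entriesIn_quadratic hU hV Λ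
  have hx₁ : EntriesIn (expansionRing S) fun ρ => (X ρ).toBlocks₁₂ := fun i j => hX _ _
  have hx₂ : EntriesIn (expansionRing S) fun ρ => (X ρ).toBlocks₂₁ := fun i j => hX _ _
  have hid := id_mem_expansionRing S
  -- The diagonal blocks of the conjugation equation dictate these choices; the off-diagonal ones
  -- then become the Sylvester equations `ex` and `ey` below.
  refine ⟨X, fun ρ => P + ρ • (c₁₁ ρ + c₁₂ ρ * (X ρ).toBlocks₂₁),
    fun ρ => Q + ρ • (c₂₂ ρ + c₂₁ ρ * (X ρ).toBlocks₁₂), hX,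
    (EntriesIn.const P).add (.smul hid (.add (fun i j => hC _ _) (.mul (fun i j => hC _ _) hx₂))),
    (EntriesIn.const Q).add (.smul hid (.add (fun i j => hC _ _) (.mul (fun i j => hC _ _) hx₁))),
    hX0, ?_⟩
  filter_upwards [hXeq] with ρ hρ
  rw [hCb ρ]
  generalize c₁₁ ρ = a, c₁₂ ρ = b, c₂₁ ρ = c, c₂₂ ρ = d at *
  have hΛ : ∀ Z, ρ • Λ Z =
      Matrix.fromBlocks 0 (ρ • Λ₁ Z.toBlocks₁₂) (ρ • Λ₂ Z.toBlocks₂₁) 0 := fun Z => by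
    simp only [Λ, LinearMap.coe_mk, AddHom.coe_mk, Matrix.fromBlocks_smul, smul_zero]
  obtain ⟨x, y, hxy⟩ : ∃ x y, X ρ = Matrix.fromBlocks 0 x y 0 := ⟨_, _, hρ.trans (hΛ _)⟩
  rw [hxy] at hρ ⊢
  simp only [Matrix.fromBlocks_multiply, sub_eq_add_neg, Matrix.fromBlocks_add,
    Matrix.fromBlocks_neg, Λ, LinearMap.coe_mk, AddHom.coe_mk, Matrix.fromBlocks_smul,
    Matrix.toBlocks_fromBlocks₁₂, Matrix.toBlocks_fromBlocks₂₁, Matrix.fromBlocks_inj,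
    Matrix.zero_mul, Matrix.mul_zero, add_zero, zero_add, neg_zero, smul_zero, true_and,
    and_true] at hρ
  obtain ⟨hx, hy⟩ := hρ
  have ex : x * Q - P * x = ρ • (b + a * x + -(x * d) + -(x * c * x)) := by
    conv_rhs => rw [← hΛ₁ (b + a * x + -(x * d) + -(x * c * x))]
    rw [smul_sub, ← Matrix.smul_mul, ← Matrix.mul_smul, ← hx]
  have ey : y * P - Q * y = ρ • (c + d * y + -(y * a) + -(y * b * y)) := by
    conv_rhs => rw [← hΛ₂ (c + d * y + -(y * a) + -(y * b * y))]
    rw [smul_sub, ← Matrix.smul_mul, ← Matrix.mul_smul, ← hy]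
  rw [← Matrix.fromBlocks_one]
  simp only [Matrix.fromBlocks_multiply, Matrix.fromBlocks_add, Matrix.fromBlocks_smul,
    Matrix.toBlocks_fromBlocks₁₂, Matrix.toBlocks_fromBlocks₂₁, Matrix.fromBlocks_inj,
    Matrix.mul_zero, add_zero, zero_add, Matrix.mul_one,
    Matrix.one_mul, Matrix.mul_add, Matrix.add_mul, Matrix.mul_smul, Matrix.smul_mul, smul_add,
    smul_neg, Matrix.mul_assoc] at ex ey ⊢
  refine ⟨by abel, ?_, ?_, by abel⟩
  · rw [sub_eq_iff_eq_add] at ex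
    rw [ex]; abel
  · rw [sub_eq_iff_eq_add] at ey
    rw [ey]; abel

end Sylvester

/-! ### Passing between matrix expansions and entrywise expansions -/

section Expansion

variable {S : Set ℂ} {n : ℕ}

theorem HasFullExpansion.entry {A : ℂ → Matrix (Fin n) (Fin n) ℂ}
    {a : ℕ → Matrix (Fin n) (Fin n) ℂ} (h : HasFullExpansion S A a) (i j : Fin n) :
    HasScalarExpansion S (fun ρ => A ρ i j) (fun k => a k i j) := fun N => by
  simpa [Matrix.sum_apply] using h N i j

theorem hasFullExpansion_of_entry {A : ℂ → Matrix (Fin n) (Fin n) ℂ}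
    {a : ℕ → Matrix (Fin n) (Fin n) ℂ}
    (h : ∀ i j, HasScalarExpansion S (fun ρ => A ρ i j) (fun k => a k i j)) :
    HasFullExpansion S A a := fun N i j => by
  simpa [Matrix.sum_apply] using h i j N

theorem EntriesIn.exists_hasFullExpansion {A : ℂ → Matrix (Fin n) (Fin n) ℂ}
    (hA : EntriesIn (expansionRing S) A) : ∃ a, HasFullExpansion S A a := by
  choose a ha using fun i j => mem_expansionRing.1 (hA i j)
  exact ⟨fun k => Matrix.of fun i j => a i j k, hasFullExpansion_of_entry fun i j => ha i j⟩

theorem HasFullExpansion.entriesIn {A : ℂ → Matrix (Fin n) (Fin n) ℂ}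
    {a : ℕ → Matrix (Fin n) (Fin n) ℂ} (h : HasFullExpansion S A a) :
    EntriesIn (expansionRing S) A := fun i j => mem_expansionRing.2 ⟨_, h.entry i j⟩

theorem HasScalarExpansion.sum_mul {ι : Type*} (s : Finset ι) (c : ι → ℂ) {f : ι → ℂ → ℂ}
    {a : ι → ℕ → ℂ} (h : ∀ i, HasScalarExpansion S (f i) (a i)) :
    HasScalarExpansion S (fun ρ => ∑ i ∈ s, c i * f i ρ) (fun k => ∑ i ∈ s, c i * a i k) := by
  intro N
  refine (IsBigO.fun_sum (s := s) fun i _ => (h i N).const_mul_left (c i)).congr_left fun ρ => ?_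
  simp only [mul_sub, Finset.sum_sub_distrib, Finset.mul_sum]
  rw [Finset.sum_comm]
  congr 1
  exact Finset.sum_congr rfl fun k _ => Finset.sum_congr rfl fun i _ => by ring

theorem HasFullExpansion.conj {m : ℕ} {A : ℂ → Matrix (Fin n) (Fin n) ℂ}
    {a : ℕ → Matrix (Fin n) (Fin n) ℂ} (h : HasFullExpansion S A a) (P' : Matrix (Fin m) (Fin n) ℂ)
    (P : Matrix (Fin n) (Fin m) ℂ) :
    HasFullExpansion S (fun ρ => P' * A ρ * P) (fun k => P' * a k * P) := by
  refine hasFullExpansion_of_entry fun i j => ?_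
  have key : ∀ B : Matrix (Fin n) (Fin n) ℂ, (P' * B * P) i j =
      ∑ p : Fin n × Fin n, (P' i p.1 * P p.2 j) * B p.1 p.2 := fun B => by
    simp only [Matrix.mul_apply, Finset.sum_mul, Fintype.sum_prod_type]
    rw [Finset.sum_comm]
    exact Finset.sum_congr rfl fun _ _ => Finset.sum_congr rfl fun _ _ => by ring
  simp only [key]
  exact HasScalarExpansion.sum_mul _ _ fun p => h.entry p.1 p.2

/-- A family whose leading coefficients are scalar is a polynomial up to the first deviation. -/
theorem HasFullExpansion.hasBlockForm {A : ℂ → Matrix (Fin n) (Fin n) ℂ}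
    {a : ℕ → Matrix (Fin n) (Fin n) ℂ} (h : HasFullExpansion S A a) {k : ℕ} {s : ℕ → ℂ}
    {J : Matrix (Fin n) (Fin n) ℂ} (hs : ∀ l < k, a l = s l • 1) (hk : a k = s k • 1 + J) :
    HasBlockForm S A k J := by
  refine ⟨∑ l ∈ Finset.range (k + 1), Polynomial.monomial l (s l), ?_, ?_⟩
  · refine Polynomial.natDegree_sum_le_of_forall_le _ _ fun l hl => ?_
    exact (Polynomial.natDegree_monomial_le _).trans (Nat.lt_succ_iff.1 (Finset.mem_range.1 hl))
  · have key : ∀ ρ : ℂ, ∑ l ∈ Finset.range (k + 1), ρ ^ l • a l =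
        (∑ l ∈ Finset.range (k + 1), Polynomial.monomial l (s l)).eval ρ • 1 + ρ ^ k • J := by
      intro ρ
      rw [Finset.sum_range_succ, hk, Finset.sum_congr rfl fun l hl => by
        rw [hs l (Finset.mem_range.1 hl)], Polynomial.eval_finsetSum, Finset.sum_range_succ,
        add_smul, Finset.sum_smul, smul_add, add_assoc]
      simp only [Polynomial.eval_monomial, smul_smul, mul_comm]
    simpa only [key] using h (k + 1)

/-- If all coefficients before the `k`-th are scalar, the family is
`q(ρ) I + ρ ^ k (a k + ρ C(ρ))`, where `q` and `C` have full expansions. -/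
theorem HasFullExpansion.exists_eq_scalar_add {A : ℂ → Matrix (Fin n) (Fin n) ℂ}
    {a : ℕ → Matrix (Fin n) (Fin n) ℂ} (h : HasFullExpansion S A a) {k : ℕ} {s : ℕ → ℂ}
    (hs : ∀ l < k, a l = s l • 1) :
    ∃ q ∈ expansionRing S, ∃ C : ℂ → Matrix (Fin n) (Fin n) ℂ, EntriesIn (expansionRing S) C ∧
      ∀ᶠ ρ in 𝓝[S] 0, A ρ = q ρ • 1 + ρ ^ k • (a k + ρ • C ρ) := by
  -- Shifting by `k + 1` leaves the coefficient `a k` explicit and puts everything beyond it into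
  -- `C`.
  choose c hc hcA using fun i j => (h.entry i j).exists_shift_iterate (k + 1)
  refine ⟨∑ l ∈ Finset.range k, s l • id ^ l, sum_mem fun l _ =>
    Subalgebra.smul_mem _ (pow_mem (id_mem_expansionRing S) l) _,
    fun ρ => Matrix.of fun i j => c i j ρ, fun i j => mem_expansionRing.2 ⟨_, hc i j⟩, ?_⟩
  filter_upwards [eventually_all.2 fun i => eventually_all.2 fun j => hcA i j] with ρ hρ
  ext i j
  rw [hρ i j, Finset.sum_range_succ, Finset.sum_congr rfl fun l hl => by
      rw [hs l (Finset.mem_range.1 hl)]]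
  simp only [Finset.sum_apply, Pi.smul_apply, Pi.pow_apply, id, smul_eq_mul, Matrix.add_apply,
    Matrix.smul_apply, Matrix.of_apply, Finset.sum_mul]
  rw [mul_add, pow_succ, add_assoc]
  congr 1
  · exact Finset.sum_congr rfl fun _ _ => by ring
  · ring

end Expansion

/-! ### Changes of basis with full expansions -/

/-- `B` is obtained from `A`, near `0`, by a change of basis which has a full expansion along with
its inverse. -/
def ExpansionConj (S : Set ℂ) {ι κ : Type*} [Fintype ι] [DecidableEq ι] [Fintype κ] [DecidableEq κ]
    (A : ℂ → Matrix ι ι ℂ) (B : ℂ → Matrix κ κ ℂ) : Prop :=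
  ∃ (M : ℂ → Matrix ι κ ℂ) (M' : ℂ → Matrix κ ι ℂ), EntriesIn (expansionRing S) M ∧
    EntriesIn (expansionRing S) M' ∧
    ∀ᶠ ρ in 𝓝[S] 0, M ρ * M' ρ = 1 ∧ M' ρ * M ρ = 1 ∧ M' ρ * A ρ * M ρ = B ρ

namespace ExpansionConj

variable {S : Set ℂ} {ι κ l o : Type*} [Fintype ι] [DecidableEq ι] [Fintype κ] [DecidableEq κ]
  [Fintype l] [DecidableEq l] [Fintype o] [DecidableEq o]

theorem trans {A : ℂ → Matrix ι ι ℂ} {B : ℂ → Matrix κ κ ℂ} {C : ℂ → Matrix l l ℂ}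
    (h₁ : ExpansionConj S A B) (h₂ : ExpansionConj S B C) : ExpansionConj S A C := by
  obtain ⟨M, M', hM, hM', h⟩ := h₁
  obtain ⟨L, L', hL, hL', h'⟩ := h₂
  refine ⟨_, _, hM.mul hL, hL'.mul hM', ?_⟩
  filter_upwards [h, h'] with ρ h h'
  refine ⟨?_, ?_, ?_⟩
  · rw [Matrix.mul_assoc, ← Matrix.mul_assoc (L ρ), h'.1, Matrix.one_mul, h.1]
  · rw [Matrix.mul_assoc, ← Matrix.mul_assoc (M' ρ), h.2.1, Matrix.one_mul, h'.2.1]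
  · rw [← h'.2.2, ← h.2.2]
    simp only [Matrix.mul_assoc]

theorem of_eventuallyEq {A B : ℂ → Matrix ι ι ℂ} (h : A =ᶠ[𝓝[S] 0] B) : ExpansionConj S A B :=
  ⟨_, _, .const 1, .const 1, h.mono fun ρ hρ => by simp [hρ]⟩

theorem const (A : ℂ → Matrix ι ι ℂ) {P : Matrix ι κ ℂ} {P' : Matrix κ ι ℂ} (h : P * P' = 1)
    (h' : P' * P = 1) : ExpansionConj S A fun ρ => P' * A ρ * P :=
  ⟨_, _, .const P, .const P', .of_forall fun _ => ⟨h, h', rfl⟩⟩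

theorem reindex (A : ℂ → Matrix ι ι ℂ) (e : κ ≃ ι) :
    ExpansionConj S A fun ρ => (A ρ).submatrix e e := by
  refine ⟨fun _ => (1 : Matrix ι ι ℂ).submatrix id e, fun _ => (1 : Matrix ι ι ℂ).submatrix e id,
    .const _, .const _, .of_forall fun ρ => ⟨?_, ?_, ?_⟩⟩
  · simp
  · ext i j
    simp [Matrix.mul_apply, Matrix.one_apply]
  · ext i j
    simp [Matrix.mul_apply, Matrix.one_apply]

theorem scalar_add {A : ℂ → Matrix ι ι ℂ} {B : ℂ → Matrix κ κ ℂ} (h : ExpansionConj S A B)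
    (q r : ℂ → ℂ) :
    ExpansionConj S (fun ρ => q ρ • 1 + r ρ • A ρ) fun ρ => q ρ • 1 + r ρ • B ρ := by
  obtain ⟨M, M', hM, hM', h⟩ := h
  refine ⟨M, M', hM, hM', h.mono fun ρ h => ⟨h.1, h.2.1, ?_⟩⟩
  rw [Matrix.mul_add, Matrix.add_mul, Matrix.mul_smul, Matrix.smul_mul, Matrix.mul_one, h.2.1,
    Matrix.mul_smul, Matrix.smul_mul, h.2.2]

theorem fromBlocks {A₁ : ℂ → Matrix ι ι ℂ} {A₂ : ℂ → Matrix κ κ ℂ} {B₁ : ℂ → Matrix l l ℂ}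
    {B₂ : ℂ → Matrix o o ℂ} (h₁ : ExpansionConj S A₁ B₁) (h₂ : ExpansionConj S A₂ B₂) :
    ExpansionConj S (fun ρ => Matrix.fromBlocks (A₁ ρ) 0 0 (A₂ ρ))
      fun ρ => Matrix.fromBlocks (B₁ ρ) 0 0 (B₂ ρ) := by
  obtain ⟨M, M', hM, hM', h⟩ := h₁
  obtain ⟨L, L', hL, hL', h'⟩ := h₂
  refine ⟨fun ρ => Matrix.fromBlocks (M ρ) 0 0 (L ρ), fun ρ => Matrix.fromBlocks (M' ρ) 0 0 (L' ρ),
    ?_, ?_, ?_⟩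
  · rintro (i | i) (j | j)
    exacts [hM i j, zero_mem _, zero_mem _, hL i j]
  · rintro (i | i) (j | j)
    exacts [hM' i j, zero_mem _, zero_mem _, hL' i j]
  · filter_upwards [h, h'] with ρ h h'
    simp [Matrix.fromBlocks_multiply, h, h']

/-- Splitting off a nilpotent eigenvalue of the leading coefficient. -/
theorem exists_split {N₁ : Matrix ι ι ℂ} {N₂ : Matrix κ κ ℂ} (h₁ : IsNilpotent N₁)
    (h₂ : IsUnit N₂) {C : ℂ → Matrix (ι ⊕ κ) (ι ⊕ κ) ℂ} (hC : EntriesIn (expansionRing S) C) :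
    ∃ (D₁ : ℂ → Matrix ι ι ℂ) (D₂ : ℂ → Matrix κ κ ℂ), EntriesIn (expansionRing S) D₁ ∧
      EntriesIn (expansionRing S) D₂ ∧
      ExpansionConj S (fun ρ => Matrix.fromBlocks N₁ 0 0 N₂ + ρ • C ρ)
        fun ρ => Matrix.fromBlocks (D₁ ρ) 0 0 (D₂ ρ) := by
  obtain ⟨X, D₁, D₂, hX, hD₁, hD₂, hX0, h⟩ := exists_blockDiagonalization
    (fun U hU => Matrix.eq_zero_of_mul_eq_mul_of_isNilpotent h₁ h₂ hU)
    (fun U hU => Matrix.eq_zero_of_mul_eq_mul_of_isNilpotent' h₁ h₂ hU) hC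
  -- Because $X \to 0$, the matrix $1 + X$ is eventually invertible and its inverse has an expansion
  -- too.
  have hlim : Tendsto (fun ρ => 1 + X ρ) (𝓝[S] 0) (𝓝 1) := by
    simpa using hX0.const_add 1
  have hM := (EntriesIn.const (R := expansionRing S) (1 : Matrix (ι ⊕ κ) (ι ⊕ κ) ℂ)).add hX
  have hdet : Tendsto (fun ρ => (1 + X ρ).det) (𝓝[S] 0) (𝓝 1) := by
    rw [← Matrix.det_one (n := ι ⊕ κ)]
    exact ((Continuous.matrix_det continuous_id).tendsto
      (1 : Matrix (ι ⊕ κ) (ι ⊕ κ) ℂ)).comp hlim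
  refine ⟨D₁, D₂, hD₁, hD₂, _, _, hM, hM.inv (by simp) hlim, ?_⟩
  filter_upwards [h, hdet.eventually_ne one_ne_zero] with ρ h h0
  have hu := isUnit_iff_ne_zero.2 h0
  refine ⟨Matrix.mul_nonsing_inv _ hu, Matrix.nonsing_inv_mul _ hu, ?_⟩
  rw [Matrix.mul_assoc, h, Matrix.nonsing_inv_mul_cancel_left _ _ hu]

end ExpansionConj

/-! ### Reduction to blocks by induction on the size -/

/-- `A` is conjugate to a block-diagonal family, each block of which either deviates from scalar
form by a nonzero Jordan type matrix or is scalar to infinite order. -/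
def IsBlockReducible (S : Set ℂ) {ι : Type*} [Fintype ι] [DecidableEq ι]
    (A : ℂ → Matrix ι ι ℂ) : Prop :=
  ∃ (β : Type) (_ : Fintype β) (_ : DecidableEq β) (n : β → ℕ)
    (B : (j : β) → ℂ → Matrix (Fin (n j)) (Fin (n j)) ℂ),
    (∀ j, 0 < n j) ∧
    (∀ j, (∃ (k : ℕ) (J : Matrix (Fin (n j)) (Fin (n j)) ℂ),
        IsJordanType J ∧ J ≠ 0 ∧ HasBlockForm S (B j) k J) ∨
      ∀ k : ℕ, HasBlockForm S (B j) k 0) ∧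
    ExpansionConj S A fun ρ => Matrix.blockDiagonal' fun j => B j ρ

namespace IsBlockReducible

variable {S : Set ℂ}

theorem of_conj {ι κ : Type*} [Fintype ι] [DecidableEq ι] [Fintype κ] [DecidableEq κ]
    {A : ℂ → Matrix ι ι ℂ} {B : ℂ → Matrix κ κ ℂ} (h : ExpansionConj S A B)
    (hB : IsBlockReducible S B) : IsBlockReducible S A := by
  obtain ⟨β, _, _, n, C, h1, h2, h3⟩ := hB
  exact ⟨β, _, _, n, C, h1, h2, h.trans h3⟩

theorem of_isEmpty {ι : Type*} [Fintype ι] [DecidableEq ι] [IsEmpty ι] (A : ℂ → Matrix ι ι ℂ) :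
    IsBlockReducible S A := by
  refine ⟨Empty, inferInstance, inferInstance, fun _ => 1, fun j => j.elim,
    fun j => j.elim, fun j => j.elim, fun _ => 0, fun _ => 0, .const 0, .const 0, .of_forall fun ρ => ⟨?_, ?_, ?_⟩⟩ <;>
  exact Subsingleton.elim _ _

theorem of_block {n : ℕ} (hn : 0 < n) {B : ℂ → Matrix (Fin n) (Fin n) ℂ}
    (h : (∃ (k : ℕ) (J : Matrix (Fin n) (Fin n) ℂ),
        IsJordanType J ∧ J ≠ 0 ∧ HasBlockForm S B k J) ∨ ∀ k : ℕ, HasBlockForm S B k 0) :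
    IsBlockReducible S B := by
  refine ⟨Unit, inferInstance, inferInstance, fun _ => n, fun _ => B, fun _ => hn, fun _ => h, ?_⟩
  refine (ExpansionConj.reindex B ((Equiv.sigmaEquivProd Unit (Fin n)).trans
    (Equiv.punitProd (Fin n)))).trans (.of_eventuallyEq (.of_forall fun ρ => ?_))
  ext ⟨_, i⟩ ⟨_, j⟩
  simp [Matrix.blockDiagonal'_apply]

theorem fromBlocks {ι κ : Type*} [Fintype ι] [DecidableEq ι] [Fintype κ] [DecidableEq κ]
    {A₁ : ℂ → Matrix ι ι ℂ} {A₂ : ℂ → Matrix κ κ ℂ} (h₁ : IsBlockReducible S A₁)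
    (h₂ : IsBlockReducible S A₂) :
    IsBlockReducible S fun ρ => Matrix.fromBlocks (A₁ ρ) 0 0 (A₂ ρ) := by
  obtain ⟨β, _, _, n, B, hn, hB, hA₁⟩ := h₁
  obtain ⟨γ, _, _, r, C, hr, hC, hA₂⟩ := h₂
  let E : (j : β ⊕ γ) → ℂ → Matrix (Fin (Sum.elim n r j)) (Fin (Sum.elim n r j)) ℂ := fun j =>
    match j with
    | .inl j => B j
    | .inr j => C j
  refine ⟨β ⊕ γ, inferInstance, inferInstance, Sum.elim n r, E, ?_, ?_, ?_⟩
  · rintro (j | j)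
    exacts [hn j, hr j]
  · rintro (j | j)
    exacts [hB j, hC j]
  · refine ((hA₁.fromBlocks hA₂).trans (ExpansionConj.reindex _
      (Equiv.sumSigmaDistrib fun j => Fin (Sum.elim n r j)))).trans
        (.of_eventuallyEq (.of_forall fun ρ => ?_))
    ext ⟨i | i, x⟩ ⟨j | j, y⟩
    · by_cases hij : i = j
      · subst hij
        exact (Matrix.blockDiagonal'_apply_eq (fun j => B j ρ) i x y).trans
          (Matrix.blockDiagonal'_apply_eq (fun j => E j ρ) (Sum.inl i) x y).symm
      · exact (Matrix.blockDiagonal'_apply_ne (fun j => B j ρ) x y hij).trans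
          (Matrix.blockDiagonal'_apply_ne (fun j => E j ρ) x y (Sum.inl_injective.ne hij)).symm
    · exact (Matrix.blockDiagonal'_apply_ne _ _ _ Sum.inl_ne_inr).symm
    · exact (Matrix.blockDiagonal'_apply_ne _ _ _ Sum.inr_ne_inl).symm
    · by_cases hij : i = j
      · subst hij
        exact (Matrix.blockDiagonal'_apply_eq (fun j => C j ρ) i x y).trans
          (Matrix.blockDiagonal'_apply_eq (fun j => E j ρ) (Sum.inr i) x y).symm
      · exact (Matrix.blockDiagonal'_apply_ne (fun j => C j ρ) x y hij).trans
          (Matrix.blockDiagonal'_apply_ne (fun j => E j ρ) x y (Sum.inr_injective.ne hij)).symm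

theorem of_entriesIn {n : ℕ} {A : ℂ → Matrix (Fin n) (Fin n) ℂ}
    (hA : EntriesIn (expansionRing S) A) : IsBlockReducible S A := by
  classical
  induction n using Nat.strong_induction_on with
  | _ n ih =>
  rcases Nat.eq_zero_or_pos n with rfl | hn
  · exact of_isEmpty A
  -- Positive size makes the matrix algebra nontrivial, so that `a k` has an eigenvalue.
  have : NeZero n := ⟨hn.ne'⟩
  obtain ⟨a, ha⟩ := hA.exists_hasFullExpansion
  by_cases hs : ∀ l, ∃ s : ℂ, a l = s • 1
  · choose s hs using hs
    exact of_block hn (.inr fun k => ha.hasBlockForm (s := s) (fun l _ => hs l) (by simp [hs]))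
  push Not at hs
  set k := Nat.find hs with hk
  have hns : ∀ s : ℂ, a k ≠ s • 1 := Nat.find_spec hs
  have hlt : ∀ l, ∃ s : ℂ, l < k → a l = s • 1 := fun l => by
    by_cases hl : l < k
    · have := Nat.find_min hs hl
      push Not at this
      exact this.imp fun _ h _ => h
    · exact ⟨0, fun h => absurd h hl⟩
  choose s hs' using hlt
  obtain ⟨z, hz⟩ := spectrum.nonempty_of_isAlgClosed_of_finiteDimensional ℂ (a k)
  have hdet : (a k - z • 1).det = 0 := by
    rw [spectrum.mem_iff, Matrix.isUnit_iff_isUnit_det, isUnit_iff_ne_zero, not_not,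
      Algebra.algebraMap_eq_smul_one, ← neg_sub, Matrix.det_neg] at hz
    simpa using hz
  by_cases hnil : IsNilpotent (a k - z • 1)
  · obtain ⟨r, P, P', hP, hP', hJ⟩ := Matrix.exists_isJordanType_of_isNilpotent _ hnil
    refine of_conj (ExpansionConj.const A hP hP') ?_
    -- A vanishing Jordan form would make `a k` equal to `z • 1`, against the choice of `k`.
    have hJ0 : P' * (a k - z • 1) * P ≠ 0 := fun h0 => by
      have : P * (P' * (a k - z • 1) * P) * P' = a k - z • 1 := by
        rw [Matrix.mul_assoc P' _ P, ← Matrix.mul_assoc P, hP, Matrix.one_mul, Matrix.mul_assoc, hP,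
          Matrix.mul_one]
      rw [h0, Matrix.mul_zero, Matrix.zero_mul] at this
      exact hns z (sub_eq_zero.1 this.symm)
    have hr : 0 < r := by
      rcases Nat.eq_zero_or_pos r with rfl | hr
      · exact absurd (Subsingleton.elim _ _) hJ0
      · exact hr
    -- The eigenvalue `z` becomes the coefficient of $\rho^k$ in the polynomial.
    refine of_block hr (.inl ⟨k, _, hJ, hJ0, (ha.conj P' P).hasBlockForm
      (s := fun l => if l < k then s l else z) (fun l hl => ?_) ?_⟩)
    · rw [if_pos hl, hs' l hl]
      simp [hP']
    · rw [if_neg (lt_irrefl k), Matrix.mul_sub, Matrix.sub_mul]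
      simp [hP']
  · obtain ⟨r, t, P, P', N₁, N₂, hP, hP', hPN, hN₁, hN₂, hr, ht⟩ :=
      Matrix.exists_fitting _ hdet hnil
    rw [Fintype.card_fin] at hr ht
    obtain ⟨q, hq, C, hC, hAC⟩ := ha.exists_eq_scalar_add hs'
    have hC' := ((EntriesIn.const P').mul hC).mul (EntriesIn.const P)
    obtain ⟨D₁, D₂, hD₁, hD₂, hD⟩ := ExpansionConj.exists_split hN₁ hN₂ hC'
    set q' : ℂ → ℂ := fun ρ => q ρ + ρ ^ k * z with hq'
    have hrk : (fun ρ : ℂ => ρ ^ k) ∈ expansionRing S := pow_mem (id_mem_expansionRing S) k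
    have hq'mem : q' ∈ expansionRing S :=
      add_mem hq (mul_mem hrk (Subalgebra.algebraMap_mem _ z))
    have e1 : (fun ρ => P' * A ρ * P) =ᶠ[𝓝[S] 0] fun ρ =>
        q' ρ • 1 + ρ ^ k • (Matrix.fromBlocks N₁ 0 0 N₂ + ρ • (P' * C ρ * P)) := by
      filter_upwards [hAC] with ρ hρ
      rw [hρ, ← hPN, hq']
      simp only [Matrix.mul_add, Matrix.add_mul, Matrix.mul_sub, Matrix.sub_mul, Matrix.mul_smul,
        Matrix.smul_mul, Matrix.mul_one, hP', add_smul, smul_add, smul_sub, smul_smul]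
      abel
    have e2 : ∀ ρ, q' ρ • (1 : Matrix (Fin r ⊕ Fin t) (Fin r ⊕ Fin t) ℂ) +
        ρ ^ k • Matrix.fromBlocks (D₁ ρ) 0 0 (D₂ ρ) =
        Matrix.fromBlocks (q' ρ • 1 + ρ ^ k • D₁ ρ) 0 0 (q' ρ • 1 + ρ ^ k • D₂ ρ) := fun ρ => by
      rw [← Matrix.fromBlocks_one]
      simp only [Matrix.fromBlocks_smul, Matrix.fromBlocks_add, smul_zero, add_zero]
    refine of_conj (((ExpansionConj.const A hP hP').trans (.of_eventuallyEq e1)).trans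
      (hD.scalar_add q' fun ρ => ρ ^ k)) ?_
    simp only [e2]
    -- The scalar part is put back into each block before the induction is applied, so each smaller
    -- block is expanded afresh.
    exact (ih r hr ((EntriesIn.smul hq'mem (.const 1)).add (.smul hrk hD₁))).fromBlocks
      (ih t ht ((EntriesIn.smul hq'mem (.const 1)).add (.smul hrk hD₂)))

/-- The blocks can be indexed by an initial segment of the naturals. -/
theorem exists_fin {ι : Type*} [Fintype ι] [DecidableEq ι] {A : ℂ → Matrix ι ι ℂ}
    (h : IsBlockReducible S A) :
    ∃ (d : ℕ) (n : Fin d → ℕ) (B : (j : Fin d) → ℂ → Matrix (Fin (n j)) (Fin (n j)) ℂ),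
      (∀ j, 0 < n j) ∧
      (∀ j, (∃ (k : ℕ) (J : Matrix (Fin (n j)) (Fin (n j)) ℂ),
          IsJordanType J ∧ J ≠ 0 ∧ HasBlockForm S (B j) k J) ∨
        ∀ k : ℕ, HasBlockForm S (B j) k 0) ∧
      ExpansionConj S A fun ρ => Matrix.blockDiagonal' fun j => B j ρ := by
  obtain ⟨β, _, _, n, B, hn, hB, hA⟩ := h
  let e := (Fintype.equivFin β).symm
  refine ⟨Fintype.card β, fun j => n (e j), fun j => B (e j), fun j => hn _, fun j => hB _,
    (hA.trans (ExpansionConj.reindex _ (Equiv.sigmaCongrLeft (β := fun j => Fin (n j)) e))).trans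
      (.of_eventuallyEq (.of_forall fun ρ => ?_))⟩
  ext ⟨i, x⟩ ⟨j, y⟩
  by_cases hij : i = j
  · subst hij
    simp [Matrix.blockDiagonal'_apply]
  · simp [Matrix.blockDiagonal'_apply, hij]

end IsBlockReducible

/-! ### Assembly of the normal form -/

theorem theorem4 (m : ℕ) (S : Set ℂ) (A : ℂ → Matrix (Fin m) (Fin m) ℂ)
    (a : ℕ → Matrix (Fin m) (Fin m) ℂ) (hA : HasFullExpansion S A a) :
    ∃ (M : ℂ → Matrix (Fin m) (Fin m) ℂ) (c : ℕ → Matrix (Fin m) (Fin m) ℂ),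
      (∀ ρ, IsUnit (M ρ)) ∧ IsUnit (c 0) ∧ HasFullExpansion S M c ∧
      ∃ (d : ℕ) (n : Fin d → ℕ) (hn : ∑ j, n j = m)
        (B : (j : Fin d) → ℂ → Matrix (Fin (n j)) (Fin (n j)) ℂ),
        (∀ j, 0 < n j) ∧
        (∀ᶠ ρ in 𝓝[S] 0, (M ρ)⁻¹ * A ρ * M ρ = bdiag n hn (fun j => B j ρ)) ∧
        ∀ j, n j = 1 ∨
          (∃ (k : ℕ) (J : Matrix (Fin (n j)) (Fin (n j)) ℂ),
            IsJordanType J ∧ J ≠ 0 ∧ HasBlockForm S (B j) k J) ∨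
          ∀ k : ℕ, HasBlockForm S (B j) k 0 := by
  classical
  -- If $0$ is not in the closure of `S`, all asymptotic claims are void and blocks of size one will
  -- do. Otherwise some $\rho$ satisfies the conjugation equations, and an invertible matrix there
  -- forces the sizes to sum to `m`.
  rcases (𝓝[S] (0 : ℂ)).eq_or_neBot with hbot | hne
  · refine ⟨fun _ => 1, fun _ => 1, fun _ => isUnit_one, isUnit_one,
      fun N i j => by simp [hbot], m, fun _ => 1, by simp, fun _ _ => 1, fun _ => one_pos,
      by simp [hbot], fun _ => .inl rfl⟩
  obtain ⟨d, n, B, hn, hB, hconj⟩ := (IsBlockReducible.of_entriesIn hA.entriesIn).exists_fin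
  have hsum : ∑ j, n j = m := by
    obtain ⟨M, M', -, -, h⟩ := hconj
    obtain ⟨ρ, h1, h2, -⟩ := h.exists
    have := Matrix.square_of_invertible _ _ h1 h2
    simpa using this.symm
  obtain ⟨M, M', hM, hM', h⟩ := hconj.trans
    (ExpansionConj.reindex _ (finSigmaFinEquiv.trans (finCongr hsum)).symm)
  -- Invertibility is required for every $\rho$ but known only near $0$; altering `M` elsewhere does
  -- not affect its expansion.
  let L : ℂ → Matrix (Fin m) (Fin m) ℂ := fun ρ => if IsUnit (M ρ) then M ρ else 1
  have hLM : ∀ᶠ ρ in 𝓝[S] 0, L ρ = M ρ := h.mono fun ρ hρ =>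
    if_pos (IsUnit.of_mul_eq_one _ hρ.1)
  have hL : EntriesIn (expansionRing S) L := fun i j =>
    expansionRing_congr (hM i j) (hLM.mono fun ρ hρ => by simp only [hρ])
  obtain ⟨c, hc⟩ := hL.exists_hasFullExpansion
  obtain ⟨c', hc'⟩ := hM'.exists_hasFullExpansion
  have hlim : Tendsto L (𝓝[S] 0) (𝓝 (c 0)) :=
    tendsto_pi_nhds.2 fun i => tendsto_pi_nhds.2 fun j => (hc.entry i j).tendsto
  have hlim' : Tendsto M' (𝓝[S] 0) (𝓝 (c' 0)) :=
    tendsto_pi_nhds.2 fun i => tendsto_pi_nhds.2 fun j => (hc'.entry i j).tendsto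
  -- The inverse family converges as well, so the limit of the products shows that the leading
  -- coefficient is invertible.
  have hone : c 0 * c' 0 = 1 := by
    refine tendsto_nhds_unique (hlim.mul hlim') (tendsto_const_nhds.congr' ?_)
    filter_upwards [h, hLM] with ρ h1 h2
    rw [h2, h1.1]
  refine ⟨L, c, fun ρ => ?_, IsUnit.of_mul_eq_one _ hone, hc, d, n, hsum, B, hn, ?_,
    fun j => .inr (hB j)⟩
  · by_cases hρ : IsUnit (M ρ)
    · simpa only [L, if_pos hρ] using hρ
    · simp only [L, if_neg hρ, isUnit_one]
  · filter_upwards [h, hLM] with ρ h1 h2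
    rw [h2, Matrix.inv_eq_right_inv h1.1, h1.2.2]
    rfl
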